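/- Let $\Bbbk$ be a field of characteristic zero. Let $P=T(V)/(R)$ be a symmetric operad over $\Bbbk$ generated by binary operations: $V$ is a vector space with an action $\omega\mapsto\omega^{(12)}$ of $S_2$, $T(V)$ is the free operad on $V$ placed in arity two, and $R$ is any set of relations, each of which is (represented by) a linear combination of tree monomials (planar binary trees with vertices decorated by elements of $V$ and leaves labelled bijectively by a fixed finite set). The disuccessor $\mathrm{DSu}(P)$ is the binary operad with generators $\omega_\prec,\omega_\succ$ ($\omega\in V$), linear in $\omega$, with $(\omega_\prec)^{(12)}=(\omega^{(12)})_\succ$ and $(\omega_\succ)^{(12)}=(\omega^{(12)})_\prec$, and with the following relations: for each $r=\sum_i c_i\tau_i\in R$ and each leaf label $x$ of $r$, the relation $\sum_i c_i\,\mathrm{DSu}_x(\tau_i)=0$, where $\mathrm{DSu}_x(\tau)$ is obtained from the tree $\tau$ by replacing the decoration $\omega$ of each vertex on the path from the root to the leaf $x$ by $\omega_\prec$ if the path turns left at that vertex and by $\omega_\succ$ if it turns right, and the decoration $\omega$ of each other vertex by $\omega_\prec+\omega_\succ$. Consider the category of $P$-algebras $A$ with a strictly positive weight grading $A=\bigoplus_{n>0}A_n$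 (so $\omega(A_i,A_j)\subseteq A_{i+j}$ for every generator $\omega$), whose morphisms are the weight-preserving morphisms of $P$-algebras. For each such $A$ there is a unique $\mathrm{DSu}(P)$-algebra structure on the vector space $A$ for which \[ \omega_\prec(a_1,a_2)=\frac{|a_1|}{|a_1|+|a_2|}\,\omega(a_1,a_2),\qquad \omega_\succ(a_1,a_2)=\frac{|a_2|}{|a_1|+|a_2|}\,\omega(a_1,a_2) \] for all $\omega\in V$ and all homogeneous $a_1,a_2\in A$ of weights $|a_1|,|a_2|$. Moreover, assigning to $A$ the vector space $A$ with this structure, and to each morphism the same linear map, is a functor from this category to the category of $\mathrm{DSu}(P)$-algebras (the Foissy functor). -/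

import Mathlib

open CategoryTheory

universe u v w

/-! Symmetric operads (coordinate-free, by partial compositions). -/

namespace OperadEquiv

/-- `L ⊔ (M ⊔ {*}) ≃ (L ⊔ M) ⊔ {*}`. -/
def sumOption (L M : Type) : L ⊕ Option M ≃ Option (L ⊕ M) where
  toFun x := Sum.elim (fun l => some (Sum.inl l)) (fun o => o.map Sum.inr) x
  invFun y := y.elim (Sum.inr none) (Sum.map id some)
  left_inv x := by rcases x with l | _ | m <;> rfl
  right_inv y := by rcases y with _ | l | m <;> rfl

/-- `(L ⊔ {*}) ⊔ M ≃ (L ⊔ M) ⊔ {*}`. -/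
def optionSum (L M : Type) : Option L ⊕ M ≃ Option (L ⊕ M) where
  toFun x := Sum.elim (fun o => o.map Sum.inl) (fun m => some (Sum.inr m)) x
  invFun y := y.elim (Sum.inl none) (Sum.map some id)
  left_inv x := by rcases x with (_ | l) | m <;> rfl
  right_inv y := by rcases y with _ | l | m <;> rfl

/-- The exchange of the two added points of `L ⊔ {*'} ⊔ {*}`. -/
def swapOption (L : Type) : Option (Option L) ≃ Option (Option L) where
  toFun x := x.elim (some none) (fun o => o.elim none (fun l => some (some l)))
  invFun x := x.elim (some none) (fun o => o.elim none (fun l => some (some l)))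
  left_inv x := by rcases x with _ | _ | l <;> rfl
  right_inv x := by rcases x with _ | _ | l <;> rfl

/-- `(L ⊔ N) ⊔ M ≃ (L ⊔ M) ⊔ N`. -/
def sumRightComm (L M N : Type) : (L ⊕ N) ⊕ M ≃ (L ⊕ M) ⊕ N where
  toFun x := x.elim (Sum.elim (fun l => Sum.inl (Sum.inl l)) Sum.inr)
    (fun m => Sum.inl (Sum.inr m))
  invFun x := x.elim (Sum.elim (fun l => Sum.inl (Sum.inl l)) Sum.inr)
    (fun m => Sum.inl (Sum.inr m))
  left_inv x := by rcases x with (l | n) | m <;> rfl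
  right_inv x := by rcases x with (l | n) | m <;> rfl

/-- The identification of a one-point set with `∅ ⊔ {*}`. -/
def unitOption : Unit ≃ Option Empty where
  toFun _ := none
  invFun _ := ()
  left_inv _ := rfl
  right_inv x := by rcases x with _ | e
                    · rfl
                    · exact e.elim

end OperadEquiv

open OperadEquiv in
/-- A symmetric operad over `k`: a linear species `L ↦ P(L)` on finite sets (`P(L)` is the space of
operations with inputs labelled by `L`) with a unit in `P({*})` and with partial compositions
`∘_* : P(L ⊔ {*}) ⊗ P(M) → P(L ⊔ M)` inserting the second operation in the input `*` of the first;
these are natural, unital, and satisfy the sequential and parallel associativity axioms. -/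
structure SymOperad (k : Type u) [Field k] where
  obj : (L : Type) → [Finite L] → Type v
  [addCommGroup : ∀ (L : Type) [Finite L], AddCommGroup (obj L)]
  [module : ∀ (L : Type) [Finite L], Module k (obj L)]
  /-- relabelling of the inputs along a bijection -/
  map : ∀ {L M : Type} [Finite L] [Finite M], (L ≃ M) → obj L →ₗ[k] obj M
  one : obj Unit
  comp : ∀ {L M : Type} [Finite L] [Finite M], obj (Option L) →ₗ[k] obj M →ₗ[k] obj (L ⊕ M)
  map_refl : ∀ {L : Type} [Finite L] (p : obj L), map (Equiv.refl L) p = p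
  map_trans : ∀ {L M N : Type} [Finite L] [Finite M] [Finite N] (e : L ≃ M) (f : M ≃ N)
    (p : obj L), map (e.trans f) p = map f (map e p)
  comp_map : ∀ {L L' M M' : Type} [Finite L] [Finite L'] [Finite M] [Finite M'] (e : L ≃ L')
    (f : M ≃ M') (p : obj (Option L)) (q : obj M),
    comp (map e.optionCongr p) (map f q) = map (Equiv.sumCongr e f) (comp p q)
  one_comp : ∀ {M : Type} [Finite M] (q : obj M),
    comp (map unitOption one) q = map (Equiv.emptySum Empty M).symm q
  comp_one : ∀ {L : Type} [Finite L] (p : obj (Option L)),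
    comp p one = map (Equiv.optionEquivSumPUnit L) p
  assoc_seq : ∀ {L M N : Type} [Finite L] [Finite M] [Finite N] (p : obj (Option L))
    (q : obj (Option M)) (r : obj N),
    comp p (comp q r) = map (Equiv.sumAssoc L M N) (comp (map (sumOption L M) (comp p q)) r)
  assoc_par : ∀ {L M N : Type} [Finite L] [Finite M] [Finite N] (p : obj (Option (Option L)))
    (q : obj M) (r : obj N),
    comp (map (optionSum L M) (comp p q)) r =
      map (sumRightComm L M N)
        (comp (map (optionSum L N) (comp (map (swapOption L) p) r)) q)

namespace SymOperad

attribute [instance] SymOperad.addCommGroup SymOperad.module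

variable {k : Type u} [Field k]

/-! Algebras over an operad. -/

/-- The structure of an algebra over the operad `P` on the vector space `A`, that is, a morphism from
`P` to the endomorphism operad of `A`. -/
structure AlgebraOn (P : SymOperad.{u, v} k) (A : Type w) [AddCommGroup A] [Module k A] where
  act : ∀ {L : Type} [Finite L], P.obj L →ₗ[k] MultilinearMap k (fun _ : L => A) A
  act_map : ∀ {L M : Type} [Finite L] [Finite M] (e : L ≃ M) (p : P.obj L) (a : M → A),
    act (P.map e p) a = act p (fun l => a (e l))
  act_one : ∀ a : Unit → A, act P.one a = a ()
  act_comp : ∀ {L M : Type} [Finite L] [Finite M] (p : P.obj (Option L)) (q : P.obj M)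
    (a : L ⊕ M → A),
    act (P.comp p q) a =
      act p (fun o => o.elim (act q (fun m => a (Sum.inr m))) (fun l => a (Sum.inl l)))

/-- The category of algebras over `P`: objects. -/
structure AlgCat (P : SymOperad.{u, v} k) where
  carrier : Type w
  [addCommGroup : AddCommGroup carrier]
  [module : Module k carrier]
  str : P.AlgebraOn carrier

attribute [instance] AlgCat.addCommGroup AlgCat.module

/-- Morphisms of algebras: linear maps commuting with all operations of the operad. -/
@[ext]
structure AlgCat.Hom {P : SymOperad.{u, v} k} (A B : AlgCat.{u, v, w} P) where
  toLin : A.carrier →ₗ[k] B.carrier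
  map_act : ∀ {L : Type} [Finite L] (p : P.obj L) (a : L → A.carrier),
    toLin (A.str.act p a) = B.str.act p (fun l => toLin (a l))

instance (P : SymOperad.{u, v} k) : Category (AlgCat.{u, v, w} P) where
  Hom A B := AlgCat.Hom A B
  id A := ⟨LinearMap.id, fun _ _ => rfl⟩
  comp f g := ⟨g.toLin ∘ₗ f.toLin, fun p a => by simp [f.map_act, g.map_act]⟩

/-! Ideals and quotients of operads. -/

/-- An operadic ideal. -/
structure OpIdeal (P : SymOperad.{u, v} k) where
  sub : ∀ (L : Type) [Finite L], Submodule k (P.obj L)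
  map_mem : ∀ {L M : Type} [Finite L] [Finite M] (e : L ≃ M) (p : P.obj L),
    p ∈ sub L → P.map e p ∈ sub M
  comp_mem_left : ∀ {L M : Type} [Finite L] [Finite M] (p : P.obj (Option L)) (q : P.obj M),
    p ∈ sub (Option L) → P.comp p q ∈ sub (L ⊕ M)
  comp_mem_right : ∀ {L M : Type} [Finite L] [Finite M] (p : P.obj (Option L)) (q : P.obj M),
    q ∈ sub M → P.comp p q ∈ sub (L ⊕ M)

/-- The operadic ideal generated by a family of sets of operations. -/
def OpIdeal.span (P : SymOperad.{u, v} k) (S : ∀ (L : Type) [Finite L], Set (P.obj L)) :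
    OpIdeal P where
  sub L _ := ⨅ (I : OpIdeal P) (_ : ∀ (M : Type) [Finite M], S M ⊆ I.sub M), I.sub L
  map_mem e p hp := by
    simp only [Submodule.mem_iInf] at hp ⊢
    exact fun I hI => I.map_mem e p (hp I hI)
  comp_mem_left p q hp := by
    simp only [Submodule.mem_iInf] at hp ⊢
    exact fun I hI => I.comp_mem_left p q (hp I hI)
  comp_mem_right p q hp := by
    simp only [Submodule.mem_iInf] at hp ⊢
    exact fun I hI => I.comp_mem_right p q (hp I hI)

variable (P : SymOperad.{u, v} k) (I : OpIdeal P)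

/-- The partial composition induced on the quotient by an ideal. -/
def quotComp {L M : Type} [Finite L] [Finite M] :
    (P.obj (Option L) ⧸ I.sub (Option L)) →ₗ[k] (P.obj M ⧸ I.sub M) →ₗ[k]
      (P.obj (L ⊕ M) ⧸ I.sub (L ⊕ M)) :=
  ((I.sub M).liftQ
    (((I.sub (Option L)).liftQ
      ((P.comp (L := L) (M := M)).compr₂ (I.sub (L ⊕ M)).mkQ)
      (fun p hp => by
        ext q
        simpa using I.comp_mem_left p q hp)).flip)
    (fun q hq => by
      ext p
      exact (Submodule.Quotient.mk_eq_zero _).2 (I.comp_mem_right p q hq))).flip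

theorem quotComp_mk {L M : Type} [Finite L] [Finite M] (p : P.obj (Option L)) (q : P.obj M) :
    quotComp P I (Submodule.Quotient.mk p) (Submodule.Quotient.mk q) =
      Submodule.Quotient.mk (P.comp p q) := rfl

/-- The quotient operad `P / I`. -/
def quotient : SymOperad.{u, v} k where
  obj L _ := P.obj L ⧸ I.sub L
  map {L M} _ _ e := (I.sub L).mapQ (I.sub M) (P.map e) (fun p hp => I.map_mem e p hp)
  one := (I.sub Unit).mkQ P.one
  comp := quotComp P I
  map_refl := by
    intro L _ p
    obtain ⟨p, rfl⟩ := Submodule.mkQ_surjective _ p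
    simp [P.map_refl]
  map_trans := by
    intro L M N _ _ _ e f p
    obtain ⟨p, rfl⟩ := Submodule.mkQ_surjective _ p
    simp [P.map_trans]
  comp_map := by
    intro L L' M M' _ _ _ _ e f p q
    obtain ⟨p, rfl⟩ := Submodule.mkQ_surjective _ p
    obtain ⟨q, rfl⟩ := Submodule.mkQ_surjective _ q
    simp [quotComp_mk, P.comp_map]
  one_comp := by
    intro M _ q
    obtain ⟨q, rfl⟩ := Submodule.mkQ_surjective _ q
    simp [quotComp_mk, P.one_comp]
  comp_one := by
    intro L _ p
    obtain ⟨p, rfl⟩ := Submodule.mkQ_surjective _ p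
    simp [quotComp_mk, P.comp_one]
  assoc_seq := by
    intro L M N _ _ _ p q r
    obtain ⟨p, rfl⟩ := Submodule.mkQ_surjective _ p
    obtain ⟨q, rfl⟩ := Submodule.mkQ_surjective _ q
    obtain ⟨r, rfl⟩ := Submodule.mkQ_surjective _ r
    simp [quotComp_mk, P.assoc_seq]
  assoc_par := by
    intro L M N _ _ _ p q r
    obtain ⟨p, rfl⟩ := Submodule.mkQ_surjective _ p
    obtain ⟨q, rfl⟩ := Submodule.mkQ_surjective _ q
    obtain ⟨r, rfl⟩ := Submodule.mkQ_surjective _ r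
    simp [quotComp_mk, P.assoc_par p q r]

end SymOperad

/-! Planar binary trees with labelled leaves and decorated vertices. -/

/-- Planar binary trees with vertices decorated by `V` and leaves labelled by `L`. -/
inductive BinTree (V : Type v) (L : Type) : Type v
  | leaf (l : L) : BinTree V L
  | node (ω : V) (s t : BinTree V L) : BinTree V L

namespace BinTree

variable {V : Type v} {L M N : Type}

/-- The labels of the leaves, from left to right. -/
def leaves : BinTree V L → List L
  | leaf l => [l]
  | node _ s t => s.leaves ++ t.leaves

/-- Substitution of trees for the leaves. -/
def bind : BinTree V L → (L → BinTree V M) → BinTree V M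
  | leaf l, f => f l
  | node ω s t, f => node ω (s.bind f) (t.bind f)

/-- Relabelling of the leaves. -/
def map (f : L → M) (t : BinTree V L) : BinTree V M := t.bind (fun l => leaf (f l))

/-- Grafting of `s` on the leaf `*` of `t`. -/
def graft (t : BinTree V (Option L)) (s : BinTree V M) : BinTree V (L ⊕ M) :=
  t.bind (fun o => o.elim (s.map Sum.inr) (fun l => leaf (Sum.inl l)))

theorem bind_bind (t : BinTree V L) (f : L → BinTree V M) (g : M → BinTree V N) :
    (t.bind f).bind g = t.bind (fun l => (f l).bind g) := by
  induction t with
  | leaf l => rfl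
  | node ω s t hs ht => simp [bind, hs, ht]

theorem bind_leaf (t : BinTree V L) : t.bind leaf = t := by
  induction t with
  | leaf l => rfl
  | node ω s t hs ht => simp [bind, hs, ht]

theorem leaves_bind (t : BinTree V L) (f : L → BinTree V M) :
    (t.bind f).leaves = t.leaves.flatMap (fun l => (f l).leaves) := by
  induction t with
  | leaf l => simp [bind, leaves]
  | node ω s t hs ht => simp [bind, leaves, hs, ht]

theorem leaves_map (t : BinTree V L) (f : L → M) : (t.map f).leaves = t.leaves.map f := by
  rw [map, leaves_bind]
  simp only [leaves]
  exact (List.map_eq_flatMap).symm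

/-- Every label occurs exactly once. -/
def IsMultilinear (t : BinTree V L) : Prop := t.leaves.Nodup ∧ ∀ l : L, l ∈ t.leaves

theorem IsMultilinear.map {t : BinTree V L} (h : t.IsMultilinear) (e : L ≃ M) :
    (t.map e).IsMultilinear := by
  refine ⟨?_, fun m => ?_⟩
  · rw [leaves_map]
    exact h.1.map e.injective
  · rw [leaves_map]
    exact List.mem_map.2 ⟨e.symm m, h.2 _, by simp⟩

theorem IsMultilinear.graft {t : BinTree V (Option L)} {s : BinTree V M} (ht : t.IsMultilinear)
    (hs : s.IsMultilinear) : (t.graft s).IsMultilinear := by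
  refine ⟨?_, fun x => ?_⟩
  · rw [BinTree.graft, leaves_bind, List.nodup_flatMap]
    refine ⟨?_, ?_⟩
    · rintro (_ | l) _
      · simpa [leaves_map] using hs.1.map Sum.inr_injective
      · simp [leaves]
    · refine ht.1.imp ?_
      rintro (_ | l) (_ | l') hne
      · exact absurd rfl hne
      · simp [Function.onFun, leaves_map, leaves]
      · simp [Function.onFun, leaves_map, leaves]
      · have hll : l' ≠ l := fun h => hne (by rw [h])
        simpa [Function.onFun, List.disjoint_left, leaves] using fun h => hll h
  · rw [BinTree.graft, leaves_bind, List.mem_flatMap]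
    rcases x with l | m
    · exact ⟨some l, ht.2 _, by simp [leaves]⟩
    · exact ⟨none, ht.2 _, by simp [leaves_map, hs.2]⟩

/-- Replace every decoration `ω` by `ω_≺ + ω_≻`. Pairs `(α, β)` stand for `α_≺ + β_≻`. -/
def star : BinTree V L → BinTree (V × V) L
  | leaf l => leaf l
  | node ω s t => node (ω, ω) s.star t.star

open Classical in
/-- The disuccessor of a tree with respect to its leaf `x`: a vertex `ω` on the path from the root
to `x` is replaced by `ω_≺` if the path turns left at it and by `ω_≻` if the path turns right;
all other vertices are replaced by `ω_≺ + ω_≻`. Pairs `(α, β)` stand for `α_≺ + β_≻`. -/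
noncomputable def disuccessor [Zero V] (x : L) : BinTree V L → BinTree (V × V) L
  | leaf l => leaf l
  | node ω s t =>
    if x ∈ s.leaves then node (ω, 0) (s.disuccessor x) t.star
    else node (0, ω) s.star (t.disuccessor x)

theorem leaves_star (t : BinTree V L) : t.star.leaves = t.leaves := by
  induction t with
  | leaf l => rfl
  | node ω s t hs ht => simp [star, leaves, hs, ht]

theorem leaves_disuccessor [Zero V] (x : L) (t : BinTree V L) :
    (t.disuccessor x).leaves = t.leaves := by
  induction t with
  | leaf l => rfl
  | node ω s t hs ht =>
    rw [disuccessor]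
    split_ifs <;> simp [leaves, hs, ht, leaves_star]

end BinTree

/-- Tree monomials: binary trees in which each label occurs exactly once. -/
def TreeMonomial (V : Type v) (L : Type) : Type v := {t : BinTree V L // t.IsMultilinear}

namespace TreeMonomial

variable {V : Type v} {L M : Type}

def map (e : L ≃ M) (t : TreeMonomial V L) : TreeMonomial V M := ⟨t.1.map e, t.2.map e⟩

def graft (t : TreeMonomial V (Option L)) (s : TreeMonomial V M) : TreeMonomial V (L ⊕ M) :=
  ⟨t.1.graft s.1, t.2.graft s.2⟩

/-- The trivial tree. -/
def trivial : TreeMonomial V Unit := ⟨.leaf (), by simp [BinTree.IsMultilinear, BinTree.leaves]⟩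

/-- The tree with one vertex, representing the operation `ω(a_0, a_1)`. -/
def corolla (ω : V) : TreeMonomial V (Fin 2) :=
  ⟨.node ω (.leaf 0) (.leaf 1), by
    constructor
    · simp [BinTree.leaves]
    · intro l
      fin_cases l <;> simp [BinTree.leaves]⟩

noncomputable def disuccessor [Zero V] (x : L) (t : TreeMonomial V L) : TreeMonomial (V × V) L :=
  ⟨t.1.disuccessor x, by
    rw [BinTree.IsMultilinear, BinTree.leaves_disuccessor]
    exact t.2⟩

end TreeMonomial

/-- The bilinear extension of the grafting of tree monomials. -/
noncomputable def treeComp (k : Type u) [Field k] (V : Type v) (L M : Type) :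
    (TreeMonomial V (Option L) →₀ k) →ₗ[k] (TreeMonomial V M →₀ k) →ₗ[k]
      (TreeMonomial V (L ⊕ M) →₀ k) :=
  Finsupp.linearCombination k (fun t => Finsupp.lmapDomain k k (fun s => t.graft s))

theorem treeComp_single (k : Type u) [Field k] (V : Type v) (L M : Type)
    (t : TreeMonomial V (Option L)) (s : TreeMonomial V M) (a b : k) :
    treeComp k V L M (Finsupp.single t a) (Finsupp.single s b) =
      Finsupp.single (t.graft s) (a * b) := by
  simp [treeComp, Finsupp.linearCombination_single, Finsupp.mapDomain_single]

/-- The operad of linear combinations of tree monomials with vertices decorated by the set `V`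
(no linearity or symmetry of the decorations is imposed yet). -/
noncomputable def treeOperad (k : Type u) [Field k] (V : Type v) : SymOperad.{u, max u v} k where
  obj L _ := TreeMonomial V L →₀ k
  map e := Finsupp.lmapDomain k k (TreeMonomial.map e)
  one := Finsupp.single TreeMonomial.trivial 1
  comp := treeComp k V _ _
  map_refl := by
    intro L _ p
    induction p using Finsupp.induction_linear with
    | zero => simp
    | add f g hf hg => rw [map_add, hf, hg]
    | single t a =>
      simp only [Finsupp.lmapDomain_apply, Finsupp.mapDomain_single]
      congr 1
      exact Subtype.ext (BinTree.bind_leaf _)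
  map_trans := by
    intro L M N _ _ _ e f p
    induction p using Finsupp.induction_linear with
    | zero => simp
    | add f g hf hg => simp only [map_add, hf, hg]
    | single t a =>
      simp only [Finsupp.lmapDomain_apply, Finsupp.mapDomain_single]
      congr 1
      apply Subtype.ext
      simp [TreeMonomial.map, BinTree.map, BinTree.bind_bind, BinTree.bind]
  comp_map := by
    intro L L' M M' _ _ _ _ e f p q
    induction p using Finsupp.induction_linear with
    | zero => simp
    | add f g hf hg => simp only [map_add, LinearMap.add_apply, hf, hg]
    | single t a =>
      induction q using Finsupp.induction_linear with
      | zero => simp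
      | add f g hf hg => simp only [map_add, hf, hg]
      | single s b =>
        simp only [Finsupp.lmapDomain_apply, Finsupp.mapDomain_single, treeComp_single]
        congr 1
        apply Subtype.ext
        simp only [TreeMonomial.map, TreeMonomial.graft, BinTree.graft, BinTree.map,
          BinTree.bind_bind, BinTree.bind]
        congr 1
        funext o
        rcases o with _ | l <;> simp [BinTree.bind_bind, BinTree.bind]
  one_comp := by
    intro M _ q
    induction q using Finsupp.induction_linear with
    | zero => simp
    | add f g hf hg => simp only [map_add, hf, hg]
    | single s b =>
      simp only [Finsupp.lmapDomain_apply, Finsupp.mapDomain_single, treeComp_single, one_mul]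
      congr 1
  comp_one := by
    intro L _ p
    induction p using Finsupp.induction_linear with
    | zero => simp
    | add f g hf hg => simp only [map_add, LinearMap.add_apply, hf, hg]
    | single t a =>
      simp only [Finsupp.lmapDomain_apply, Finsupp.mapDomain_single, treeComp_single, mul_one]
      congr 1
      apply Subtype.ext
      simp only [TreeMonomial.map, TreeMonomial.graft, TreeMonomial.trivial, BinTree.graft,
        BinTree.map]
      congr 1
      funext o
      rcases o with _ | l <;> rfl
  assoc_seq := by
    intro L M N _ _ _ p q r
    induction p using Finsupp.induction_linear with
    | zero => simp
    | add f g hf hg => simp only [map_add, LinearMap.add_apply, hf, hg]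
    | single t a =>
      induction q using Finsupp.induction_linear with
      | zero => simp
      | add f g hf hg => simp only [map_add, LinearMap.add_apply, hf, hg]
      | single s b =>
        induction r using Finsupp.induction_linear with
        | zero => simp
        | add f g hf hg => simp only [map_add, hf, hg]
        | single r c =>
          simp only [Finsupp.lmapDomain_apply, Finsupp.mapDomain_single, treeComp_single, mul_assoc]
          congr 1
          apply Subtype.ext
          simp only [TreeMonomial.map, TreeMonomial.graft, BinTree.graft, BinTree.map,
            BinTree.bind_bind, BinTree.bind]
          congr 1
          funext o
          rcases o with _ | l
          · simp only [Option.elim, BinTree.bind_bind, BinTree.bind]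
            congr 1
            funext o
            rcases o with _ | l <;>
              simp [OperadEquiv.sumOption, BinTree.bind_bind, BinTree.bind]
          · simp [OperadEquiv.sumOption, BinTree.bind]
  assoc_par := by
    intro L M N _ _ _ p q r
    induction p using Finsupp.induction_linear with
    | zero => simp
    | add f g hf hg => simp only [map_add, LinearMap.add_apply, hf, hg]
    | single t a =>
      induction q using Finsupp.induction_linear with
      | zero => simp
      | add f g hf hg => simp only [map_add, LinearMap.add_apply, hf, hg]
      | single s b =>
        induction r using Finsupp.induction_linear with
        | zero => simp
        | add f g hf hg => simp only [map_add, LinearMap.add_apply, hf, hg]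
        | single r c =>
          simp only [Finsupp.lmapDomain_apply, Finsupp.mapDomain_single, treeComp_single]
          rw [mul_right_comm]
          congr 1
          apply Subtype.ext
          simp only [TreeMonomial.map, TreeMonomial.graft, BinTree.graft, BinTree.map,
            BinTree.bind_bind, BinTree.bind]
          congr 1
          funext o
          rcases o with _ | _ | l <;>
            simp [OperadEquiv.optionSum, OperadEquiv.swapOption, OperadEquiv.sumRightComm,
              BinTree.bind_bind, BinTree.bind]

/-! Binary operads by generators and relations, and their disuccessors. -/

/-- A presentation of a binary operad: a space of binary generators `V` with the action
`ω ↦ ω^{(12)}` of the symmetric group `S_2`, and a set of relations, each of which is a linear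
combination of tree monomials with the same set of labels (of any arity). -/
structure BinaryPresentation (k : Type u) [Field k] where
  V : Type v
  [addCommGroup : AddCommGroup V]
  [module : Module k V]
  swap : V →ₗ[k] V
  swap_swap : ∀ ω, swap (swap ω) = ω
  rels : ∀ (L : Type) [Finite L], Set (TreeMonomial V L →₀ k)

namespace BinaryPresentation

attribute [instance] BinaryPresentation.addCommGroup BinaryPresentation.module

variable {k : Type u} [Field k] (D : BinaryPresentation.{u, v} k)

/-- What is set to zero in the operad: trees are linear in the decorations,
`ω^{(12)}(a_0, a_1) = ω(a_1, a_0)`, and the relations of the presentation hold. -/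
inductive Relator : ∀ (L : Type) [Finite L], (TreeMonomial D.V L →₀ k) → Prop
  | add (ω ω' : D.V) : Relator (Fin 2)
      (Finsupp.single (.corolla (ω + ω')) 1 - Finsupp.single (.corolla ω) 1
        - Finsupp.single (.corolla ω') 1)
  | smul (c : k) (ω : D.V) : Relator (Fin 2)
      (Finsupp.single (.corolla (c • ω)) 1 - c • Finsupp.single (.corolla ω) 1)
  | symm (ω : D.V) : Relator (Fin 2)
      (Finsupp.single (.corolla (D.swap ω)) 1
        - Finsupp.single ((TreeMonomial.corolla ω).map (Equiv.swap 0 1)) 1)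
  | rel (L : Type) [Finite L] (r : TreeMonomial D.V L →₀ k) (hr : r ∈ D.rels L) : Relator L r

/-- The operad `T(V)/(R)`, the quotient of the free operad on `V` by the ideal generated by `R`. -/
noncomputable def operad : SymOperad.{u, max u v} k :=
  (treeOperad k D.V).quotient
    (SymOperad.OpIdeal.span (treeOperad k D.V) (fun L _ => {r | D.Relator L r}))

/-- The binary operation of `T(V)/(R)` given by the generator `ω`. -/
noncomputable def gen (ω : D.V) : D.operad.obj (Fin 2) :=
  Submodule.Quotient.mk (p := (SymOperad.OpIdeal.span (treeOperad k D.V)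
    (fun L _ => {r | D.Relator L r})).sub (Fin 2)) (Finsupp.single (TreeMonomial.corolla ω) 1)

/-- The disuccessor `DSu(P)` of `P = T(V)/(R)`. It is generated by the symbols `ω_≺ = (ω, 0)` and
`ω_≻ = (0, ω)`, linear in `ω ∈ V`, with `(ω_≺)^{(12)} = (ω^{(12)})_≻` and
`(ω_≻)^{(12)} = (ω^{(12)})_≺`; its relations are the disuccessors of the relations of `P` with
respect to all labels `x`. -/
noncomputable def disuccessor : BinaryPresentation.{u, v} k where
  V := D.V × D.V
  swap := (D.swap ∘ₗ LinearMap.snd k D.V D.V).prod (D.swap ∘ₗ LinearMap.fst k D.V D.V)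
  swap_swap := by
    rintro ⟨α, β⟩
    simp [D.swap_swap]
  rels L _ := {r' | ∃ r ∈ D.rels L, ∃ x : L,
    r' = Finsupp.mapDomain (TreeMonomial.disuccessor x) r}

/-- The generator `ω_≺` of the disuccessor. -/
noncomputable def genPrec (ω : D.V) : D.disuccessor.operad.obj (Fin 2) :=
  D.disuccessor.gen ((ω, 0) : D.V × D.V)

/-- The generator `ω_≻` of the disuccessor. -/
noncomputable def genSucc (ω : D.V) : D.disuccessor.operad.obj (Fin 2) :=
  D.disuccessor.gen ((0, ω) : D.V × D.V)

/-- `P`-algebras with a strictly positive weight grading `A = ⨁_{n > 0} A_n`; the operations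
are homogeneous for the total weight (it suffices to require this of the generators of `P`). -/
structure PosGradedAlg where
  carrier : Type w
  [addCommGroup : AddCommGroup carrier]
  [module : Module k carrier]
  str : D.operad.AlgebraOn carrier
  piece : ℕ+ → Submodule k carrier
  isInternal : DirectSum.IsInternal piece
  act_mem : ∀ (ω : D.V) (i j : ℕ+), ∀ x ∈ piece i, ∀ y ∈ piece j,
    str.act (D.gen ω) ![x, y] ∈ piece (i + j)

attribute [instance] PosGradedAlg.addCommGroup PosGradedAlg.module

variable {D}

/-- Morphisms of `P`-algebras that preserve the weight. -/
@[ext]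
structure PosGradedAlg.Hom (A B : PosGradedAlg.{u, v, w} D) where
  toLin : A.carrier →ₗ[k] B.carrier
  map_act : ∀ {L : Type} [Finite L] (p : D.operad.obj L) (a : L → A.carrier),
    toLin (A.str.act p a) = B.str.act p (fun l => toLin (a l))
  map_piece : ∀ (i : ℕ+), ∀ x ∈ A.piece i, toLin x ∈ B.piece i

instance : Category (PosGradedAlg.{u, v, w} D) where
  Hom A B := PosGradedAlg.Hom A B
  id A := ⟨LinearMap.id, fun _ _ => rfl, fun _ _ hx => hx⟩
  comp f g := ⟨g.toLin ∘ₗ f.toLin, fun p a => by simp [f.map_act, g.map_act],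
    fun i x hx => g.map_piece i _ (f.map_piece i x hx)⟩

/-- The generating operations of a `DSu(P)`-algebra structure on `A` are
`ω_≺(x, y) = |x| / (|x| + |y|) ω(x, y)` and `ω_≻(x, y) = |y| / (|x| + |y|) ω(x, y)`. -/
def IsFoissy (A : PosGradedAlg.{u, v, w} D) (β : D.disuccessor.operad.AlgebraOn A.carrier) :
    Prop :=
  ∀ (ω : D.V) (i j : ℕ+), ∀ x ∈ A.piece i, ∀ y ∈ A.piece j,
    β.act (D.genPrec ω) ![x, y]
        = (((i : ℕ) : k) / (((i : ℕ) : k) + ((j : ℕ) : k))) • A.str.act (D.gen ω) ![x, y] ∧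
    β.act (D.genSucc ω) ![x, y]
        = (((j : ℕ) : k) / (((i : ℕ) : k) + ((j : ℕ) : k))) • A.str.act (D.gen ω) ![x, y]

end BinaryPresentation

/-!
The point is a telescoping product. Let `A` be a positively graded algebra over `P = T(V)/(R)`, and
let the generator `α_≺ + β_≻` of the disuccessor act on homogeneous elements by
`|x| / (|x| + |y|) α(x, y) + |y| / (|x| + |y|) β(x, y)` (`foissyOp`). Then `ω_≺ + ω_≻` acts as `ω`,
and in a tree `τ` evaluated at homogeneous arguments each vertex on the path from the root to the
leaf `x` contributes the quotient of the weight of the branch containing `x` by the weight of the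
whole subtree at that vertex. The product of these factors is `|x|` divided by the sum of the
weights of all arguments (`BinTree.eval_disuccessor`). Every tree monomial in a relation `r` has
each label exactly once, so this scalar is the same for all of them, and the disuccessor of `r` at
`x` acts as a multiple of `r`, that is, by zero (`treeAct_foissyOp_disuccessor`). Characteristic
zero makes the denominators invertible.

It remains to pass between algebras over the operad and bilinear operations on a space. Bilinear
operations are extended to all trees by evaluation (`treeAlgebra`), and this descends to the
quotient operad as soon as the relations evaluate to zero (`algebraOfOps`). Conversely every tree
monomial is a composite of one-vertex trees, so an algebra is determined by the operations of its
generators (`SymOperad.AlgebraOn.eq_treeAlgebra`, `algebraOn_ext`). As homogeneous elements span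
`A`, this gives uniqueness; functoriality holds because a weight-preserving morphism commutes with
the rescaled operations, hence with all trees.
-/

/-! ### Bilinear maps -/

theorem Function.update_pair_zero {A : Type*} (x y z : A) :
    Function.update ![x, y] 0 z = ![z, y] := by
  funext i
  fin_cases i <;> rfl

theorem Function.update_pair_one {A : Type*} (x y z : A) :
    Function.update ![x, y] 1 z = ![x, z] := by
  funext i
  fin_cases i <;> rfl

/-- A multilinear map in two variables as a bilinear map. -/
def MultilinearMap.toBilinear {k A B : Type*} [Field k] [AddCommGroup A] [Module k A]
    [AddCommGroup B] [Module k B] (f : MultilinearMap k (fun _ : Fin 2 => A) B) :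
    A →ₗ[k] A →ₗ[k] B :=
  LinearMap.mk₂ k (fun x y => f ![x, y])
    (fun x x' y => by
      have h := f.map_update_add ![0, y] 0 x x'
      simpa only [Function.update_pair_zero] using h)
    (fun c x y => by
      have h := f.map_update_smul ![0, y] 0 c x
      simpa only [Function.update_pair_zero] using h)
    (fun x y y' => by
      have h := f.map_update_add ![x, 0] 1 y y'
      simpa only [Function.update_pair_one] using h)
    (fun c x y => by
      have h := f.map_update_smul ![x, 0] 1 c y
      simpa only [Function.update_pair_one] using h)

@[simp]
theorem MultilinearMap.toBilinear_apply {k A B : Type*} [Field k] [AddCommGroup A] [Module k A]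
    [AddCommGroup B] [Module k B] (f : MultilinearMap k (fun _ : Fin 2 => A) B) (x y : A) :
    f.toBilinear x y = f ![x, y] := rfl

/-! ### Evaluation of trees -/

namespace BinTree

variable {k : Type u} [Field k] {V : Type v} {A : Type w} [AddCommGroup A] [Module k A]
  {L M : Type}

/-- The value of a tree whose vertices are interpreted by bilinear operations `m ω` on `A` and
whose leaves are interpreted by elements of `A`. -/
def eval (m : V → A →ₗ[k] A →ₗ[k] A) : BinTree V L → (L → A) → A
  | leaf l, a => a l
  | node ω s t, a => m ω (s.eval m a) (t.eval m a)

variable (m : V → A →ₗ[k] A →ₗ[k] A)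

theorem eval_bind (t : BinTree V L) (f : L → BinTree V M) (a : M → A) :
    (t.bind f).eval m a = t.eval m (fun l => (f l).eval m a) := by
  induction t with
  | leaf l => rfl
  | node ω s t hs ht => simp [bind, eval, hs, ht]

theorem eval_map (t : BinTree V L) (f : L → M) (a : M → A) :
    (t.map f).eval m a = t.eval m (fun l => a (f l)) :=
  eval_bind m t _ a

theorem eval_graft (t : BinTree V (Option L)) (s : BinTree V M) (a : L ⊕ M → A) :
    (t.graft s).eval m a =
      t.eval m (fun o => o.elim (s.eval m (fun i => a (Sum.inr i))) (fun l => a (Sum.inl l))) := by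
  rw [graft, eval_bind]
  congr 1
  funext o
  rcases o with _ | l
  · exact eval_map m s _ a
  · rfl

theorem eval_update_of_notMem [DecidableEq L] {t : BinTree V L} {l : L} (hl : l ∉ t.leaves)
    (a : L → A) (x : A) : t.eval m (Function.update a l x) = t.eval m a := by
  induction t with
  | leaf l' =>
    have : l' ≠ l := fun h => hl (by simp [leaves, h])
    simp [eval, this]
  | node ω s t hs ht =>
    simp only [leaves, List.mem_append, not_or] at hl
    simp [eval, hs hl.1, ht hl.2]

theorem eval_update_add [DecidableEq L] {t : BinTree V L} (ht : t.leaves.Nodup) {l : L}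
    (hl : l ∈ t.leaves) (a : L → A) (x y : A) :
    t.eval m (Function.update a l (x + y)) =
      t.eval m (Function.update a l x) + t.eval m (Function.update a l y) := by
  induction t with
  | leaf l' =>
    obtain rfl : l = l' := by simpa [leaves] using hl
    simp [eval]
  | node ω s t hs ht' =>
    rw [leaves, List.nodup_append'] at ht
    rcases List.mem_append.1 hl with h | h
    · simp [eval, hs ht.1 h, eval_update_of_notMem m (ht.2.2 h)]
    · have h' : l ∉ s.leaves := fun h' => ht.2.2 h' h
      simp [eval, ht' ht.2.1 h, eval_update_of_notMem m h']

theorem eval_update_smul [DecidableEq L] {t : BinTree V L} (ht : t.leaves.Nodup) {l : L}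
    (hl : l ∈ t.leaves) (a : L → A) (c : k) (x : A) :
    t.eval m (Function.update a l (c • x)) = c • t.eval m (Function.update a l x) := by
  induction t with
  | leaf l' =>
    obtain rfl : l = l' := by simpa [leaves] using hl
    simp [eval]
  | node ω s t hs ht' =>
    rw [leaves, List.nodup_append'] at ht
    rcases List.mem_append.1 hl with h | h
    · simp [eval, hs ht.1 h, eval_update_of_notMem m (ht.2.2 h)]
    · have h' : l ∉ s.leaves := fun h' => ht.2.2 h' h
      simp [eval, ht' ht.2.1 h, eval_update_of_notMem m h']

/-- A linear map that commutes with the operations at the vertices commutes with all trees. -/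
theorem map_eval {B : Type w} [AddCommGroup B] [Module k B] {m : V → A →ₗ[k] A →ₗ[k] A}
    {m' : V → B →ₗ[k] B →ₗ[k] B} (f : A →ₗ[k] B)
    (hf : ∀ ω x y, f (m ω x y) = m' ω (f x) (f y)) (t : BinTree V L) (a : L → A) :
    f (t.eval m a) = t.eval m' (fun l => f (a l)) := by
  induction t with
  | leaf l => rfl
  | node ω s t hs ht => simp [eval, hf, hs, ht]

/-- A tree whose leaf labels lie in `S` is relabelled from a tree with labels in the type `S`. -/
theorem exists_map_subtype_val (S : Set L) (t : BinTree V L) (h : ∀ l ∈ t.leaves, l ∈ S) :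
    ∃ t' : BinTree V S, t'.map Subtype.val = t := by
  induction t with
  | leaf l => exact ⟨leaf ⟨l, h l (by simp [leaves])⟩, rfl⟩
  | node ω s t hs ht =>
    obtain ⟨s', hs'⟩ := hs fun l hl => h l (by simp [leaves, hl])
    obtain ⟨t', ht'⟩ := ht fun l hl => h l (by simp [leaves, hl])
    refine ⟨node ω s' t', ?_⟩
    rw [← hs', ← ht']
    rfl

/-- A tree without repeated labels becomes multilinear once its labels are restricted to those
which occur. -/
theorem exists_treeMonomial_map_subtype_val (t : BinTree V L) (h : t.leaves.Nodup) :
    ∃ t' : TreeMonomial V {l // l ∈ t.leaves}, t'.1.map Subtype.val = t := by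
  obtain ⟨t', ht'⟩ := exists_map_subtype_val {l | l ∈ t.leaves} t fun _ h => h
  have hl : t'.leaves.map Subtype.val = t.leaves := by rw [← leaves_map, ht']
  refine ⟨⟨t', List.Nodup.of_map Subtype.val (hl.symm ▸ h), ?_⟩, ht'⟩
  rintro ⟨l, hmem⟩
  have : l ∈ t'.leaves.map Subtype.val := by rw [hl]; exact hmem
  obtain ⟨⟨_, _⟩, hx, rfl⟩ := List.mem_map.1 this
  exact hx

end BinTree

/-- The multilinear operation given by a tree monomial. -/
def TreeMonomial.eval {k : Type u} [Field k] {V : Type v} {A : Type w} [AddCommGroup A]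
    [Module k A] (m : V → A →ₗ[k] A →ₗ[k] A) {L : Type} (t : TreeMonomial V L) :
    MultilinearMap k (fun _ : L => A) A where
  toFun := t.1.eval m
  map_update_add' a l x y := BinTree.eval_update_add m t.2.1 (t.2.2 l) a x y
  map_update_smul' a l c x := BinTree.eval_update_smul m t.2.1 (t.2.2 l) a c x

/-! ### Algebras over quotients of operads -/

namespace SymOperad

variable {k : Type u} [Field k] {P : SymOperad.{u, v} k} {A : Type w} [AddCommGroup A] [Module k A]

namespace AlgebraOn

@[ext]
theorem ext {β β' : P.AlgebraOn A}
    (h : ∀ {L : Type} [Finite L] (p : P.obj L), β.act p = β'.act p) : β = β' := by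
  obtain ⟨act, _, _, _⟩ := β
  obtain ⟨act', _, _, _⟩ := β'
  have : @act = @act' := by
    funext L _
    exact LinearMap.ext fun p => h p
  subst this
  rfl

/-- The ideal of the operations that act on an algebra by zero. -/
def annihilator (β : P.AlgebraOn A) : OpIdeal P where
  sub _ _ := LinearMap.ker β.act
  map_mem e p hp := by
    ext a
    simp [β.act_map, LinearMap.mem_ker.1 hp]
  comp_mem_left p q hp := by
    ext a
    rw [β.act_comp, LinearMap.mem_ker.1 hp]
    rfl
  comp_mem_right p q hq := by
    ext a
    rw [β.act_comp, LinearMap.mem_ker.1 hq]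
    exact (β.act p).map_coord_zero none rfl

/-- An algebra in which the operations of `S` vanish is an algebra over the quotient by the ideal
generated by `S`. -/
def descend (β : P.AlgebraOn A) (S : ∀ (L : Type) [Finite L], Set (P.obj L))
    (hS : ∀ (L : Type) [Finite L], ∀ p ∈ S L, β.act p = 0) :
    (P.quotient (OpIdeal.span P S)).AlgebraOn A where
  act {L} _ := ((OpIdeal.span P S).sub L).liftQ β.act
    ((iInf_le _ β.annihilator).trans (iInf_le _ (by intro M _ p hp; exact hS M p hp)))
  act_map e p a := by
    obtain ⟨p, rfl⟩ := Submodule.mkQ_surjective _ p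
    exact β.act_map e p a
  act_one a := β.act_one a
  act_comp p q a := by
    obtain ⟨p, rfl⟩ := Submodule.mkQ_surjective _ p
    obtain ⟨q, rfl⟩ := Submodule.mkQ_surjective _ q
    exact β.act_comp p q a

/-- An algebra over a quotient of `P` is an algebra over `P`. -/
def ofQuotient {I : OpIdeal P} (β : (P.quotient I).AlgebraOn A) : P.AlgebraOn A where
  act {L} _ := (β.act (L := L)).comp (I.sub L).mkQ
  act_map {L _} _ _ e p a := β.act_map e ((I.sub L).mkQ p) a
  act_one a := β.act_one a
  act_comp {L M} _ _ p q a := β.act_comp ((I.sub (Option L)).mkQ p) ((I.sub M).mkQ q) a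

end AlgebraOn

end SymOperad

/-! ### Algebras over the operad of trees -/

section Trees

variable {k : Type u} [Field k] {V : Type v} {A : Type w} [AddCommGroup A] [Module k A]

/-- The action of linear combinations of tree monomials, extending the evaluation of trees. -/
noncomputable def treeAct (m : V → A →ₗ[k] A →ₗ[k] A) (L : Type) :
    (TreeMonomial V L →₀ k) →ₗ[k] MultilinearMap k (fun _ : L => A) A :=
  Finsupp.linearCombination k (fun t => t.eval m)

variable (m : V → A →ₗ[k] A →ₗ[k] A) {L M : Type}

theorem treeAct_single (t : TreeMonomial V L) (c : k) (a : L → A) :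
    treeAct m L (Finsupp.single t c) a = c • t.1.eval m a := by
  simp [treeAct, Finsupp.linearCombination_single, TreeMonomial.eval]

theorem treeAct_mapDomain (e : L ≃ M) (p : TreeMonomial V L →₀ k) (a : M → A) :
    treeAct m M (Finsupp.mapDomain (TreeMonomial.map e) p) a =
      treeAct m L p (fun l => a (e l)) := by
  induction p using Finsupp.induction_linear with
  | zero => simp
  | add f g hf hg => simp [Finsupp.mapDomain_add, hf, hg]
  | single t c =>
    simp only [Finsupp.mapDomain_single, treeAct_single]
    exact congrArg _ (BinTree.eval_map m t.1 e a)

theorem treeAct_treeComp (p : TreeMonomial V (Option L) →₀ k) (q : TreeMonomial V M →₀ k)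
    (a : L ⊕ M → A) :
    treeAct m (L ⊕ M) (treeComp k V L M p q) a =
      treeAct m (Option L) p
        (fun o => o.elim (treeAct m M q (fun i => a (Sum.inr i))) (fun l => a (Sum.inl l))) := by
  classical
  -- Linearity in `q` is linearity of the action of `p` in the variable `none`.
  have hup (x : A) : (fun o : Option L => o.elim x (fun l => a (Sum.inl l))) =
      Function.update (fun o : Option L => o.elim 0 (fun l => a (Sum.inl l))) none x := by
    funext o
    rcases o with _ | l <;> simp
  induction q using Finsupp.induction_linear with
  | zero =>
    simp only [map_zero, zero_apply]
    exact ((treeAct m (Option L) p).map_coord_zero none rfl).symm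
  | add f g hf hg =>
    rw [hup] at hf hg ⊢
    rw [map_add, map_add, add_apply, hf, hg, map_add, add_apply, MultilinearMap.map_update_add]
  | single s d =>
    rw [treeAct_single, hup, MultilinearMap.map_update_smul, ← hup]
    induction p using Finsupp.induction_linear with
    | zero => simp
    | add f g hf hg => simp only [map_add, LinearMap.add_apply, add_apply, hf, hg, smul_add]
    | single t c =>
      rw [treeComp_single, treeAct_single, treeAct_single, smul_smul, mul_comm d]
      exact congrArg _ (BinTree.eval_graft m t.1 s.1 a)

theorem treeAct_corolla (ω : V) (a : Fin 2 → A) :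
    treeAct m (Fin 2) (Finsupp.single (TreeMonomial.corolla ω) 1) a = m ω (a 0) (a 1) :=
  (treeAct_single m _ _ a).trans (one_smul _ _)

theorem treeAct_corolla_swap (ω : V) (a : Fin 2 → A) :
    treeAct m (Fin 2) (Finsupp.single ((TreeMonomial.corolla ω).map (Equiv.swap 0 1)) 1) a =
      m ω (a 1) (a 0) :=
  (treeAct_single m _ _ a).trans (one_smul _ _)

theorem map_treeAct {B : Type w} [AddCommGroup B] [Module k B]
    {m : V → A →ₗ[k] A →ₗ[k] A} {m' : V → B →ₗ[k] B →ₗ[k] B} (f : A →ₗ[k] B)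
    (hf : ∀ ω x y, f (m ω x y) = m' ω (f x) (f y)) (p : TreeMonomial V L →₀ k)
    (a : L → A) : f (treeAct m L p a) = treeAct m' L p (fun l => f (a l)) := by
  induction p using Finsupp.induction_linear with
  | zero => simp
  | add g h hg hh => simp only [map_add, add_apply, hg, hh]
  | single t c => rw [treeAct_single, treeAct_single, map_smul, BinTree.map_eval f hf]

/-- The algebra over the operad of trees in which the one-vertex trees act by given bilinear
operations. -/
noncomputable def treeAlgebra : (treeOperad k V).AlgebraOn A where
  act {L} _ := treeAct m L
  act_map e p a := treeAct_mapDomain m e p a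
  act_one a := (treeAct_single m _ _ a).trans (one_smul _ _)
  act_comp p q a := treeAct_treeComp m p q a

/-- Two disjoint lists without repetitions that exhaust a type split it into two subtypes. -/
noncomputable def sumEquivOfNodupAppend {L : Type} (l₁ l₂ : List L) (h : (l₁ ++ l₂).Nodup)
    (h' : ∀ x, x ∈ l₁ ++ l₂) : {x // x ∈ l₁} ⊕ {x // x ∈ l₂} ≃ L :=
  Equiv.ofBijective (Sum.elim Subtype.val Subtype.val) (by
    rw [List.nodup_append'] at h
    refine ⟨Subtype.val_injective.sumElim Subtype.val_injective ?_, fun x => ?_⟩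
    · rintro ⟨x, hx⟩ ⟨y, hy⟩ rfl
      exact h.2.2 hx hy
    · rcases List.mem_append.1 (h' x) with hx | hx
      · exact ⟨Sum.inl ⟨x, hx⟩, rfl⟩
      · exact ⟨Sum.inr ⟨x, hx⟩, rfl⟩)

/-- A tree monomial as an operation of the operad of trees. -/
noncomputable def treeOp (k : Type u) [Field k] {L : Type} [Finite L] (t : TreeMonomial V L) :
    (treeOperad k V).obj L :=
  (Finsupp.single t 1 : TreeMonomial V L →₀ k)

theorem treeOp_map {L M : Type} [Finite L] [Finite M] (e : L ≃ M) (t : TreeMonomial V L) :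
    treeOp k (t.map e) = (treeOperad k V).map e (treeOp k t) :=
  (Finsupp.mapDomain_single (f := TreeMonomial.map e) (a := t) (b := (1 : k))).symm

theorem treeOp_graft {L M : Type} [Finite L] [Finite M] (t : TreeMonomial V (Option L))
    (s : TreeMonomial V M) :
    treeOp k (t.graft s) = (treeOperad k V).comp (treeOp k t) (treeOp k s) := by
  refine Eq.trans ?_ (treeComp_single k V L M t s 1 1).symm
  rw [mul_one]
  rfl

namespace SymOperad.AlgebraOn

/-- The bilinear operations given by the one-vertex trees. -/
noncomputable def corollaOp (β : (treeOperad k V).AlgebraOn A) (ω : V) : A →ₗ[k] A →ₗ[k] A :=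
  (β.act (treeOp k (TreeMonomial.corolla ω))).toBilinear

/-- Every tree monomial is a composite of one-vertex trees, so it acts by the evaluation of trees.
A tree with root `ω` and branches `s`, `t` is obtained from the one-vertex tree by grafting `s` on
its first leaf and `t` on its second. -/
theorem act_treeOp (β : (treeOperad k V).AlgebraOn A) {L : Type} [Finite L]
    (t : TreeMonomial V L) (a : L → A) :
    β.act (treeOp k t) a = t.1.eval β.corollaOp a := by
  -- The label set changes in passing to branches, so the induction runs over a relabelling `T` of `t`
  -- with labels in the fixed set `L`.
  suffices H : ∀ (T : BinTree V L) (M : Type) [Finite M] (f : M → L) (t : TreeMonomial V M)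
      (a : M → A), t.1.map f = T →
      β.act (treeOp k t) a = t.1.eval β.corollaOp a from
    H t.1 L id t a (BinTree.bind_leaf _)
  clear a t
  intro T
  induction T with
  | leaf l =>
    rintro M _ f ⟨_ | ⟨ω, s, t⟩, ht⟩ a h
    · rename_i x
      have hx : ∀ y : M, y = x := fun y => by simpa [BinTree.leaves] using ht.2 y
      let e : Unit ≃ M := ⟨fun _ => x, fun _ => (), fun _ => rfl, fun y => (hx y).symm⟩
      have h1 : treeOp k (⟨.leaf x, ht⟩ : TreeMonomial V M) =
          (treeOperad k V).map e (treeOperad k V).one := treeOp_map e TreeMonomial.trivial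
      rw [h1, β.act_map, β.act_one]
      rfl
    · cases h
  | node ω₀ S T hS hT =>
    rintro M _ f ⟨_ | ⟨ω, s, t⟩, ht⟩ a h
    · cases h
    · injection h with hω hs ht'
      have hnd : (s.leaves ++ t.leaves).Nodup := ht.1
      have hmem : ∀ x, x ∈ s.leaves ++ t.leaves := ht.2
      obtain ⟨s', hss⟩ :=
        BinTree.exists_treeMonomial_map_subtype_val s (List.nodup_append'.1 hnd).1
      obtain ⟨t', htt⟩ :=
        BinTree.exists_treeMonomial_map_subtype_val t (List.nodup_append'.1 hnd).2.1
      -- `e₀` makes the first leaf the point `*` at which `s` is grafted, and `e₁` then does the same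
      -- with the other leaf, at which `t` is grafted.
      let e₀ : Fin 2 ≃ Option Unit :=
        ⟨![none, some ()], fun o => o.elim 0 fun _ => 1,
          fun i => by fin_cases i <;> rfl, fun o => by rcases o with _ | _ <;> rfl⟩
      let e₁ : Unit ⊕ {x // x ∈ s.leaves} ≃ Option {x // x ∈ s.leaves} :=
        ⟨Sum.elim (fun _ => none) some, fun o => o.elim (Sum.inl ()) Sum.inr,
          fun i => by rcases i with _ | _ <;> rfl, fun o => by rcases o with _ | _ <;> rfl⟩
      let e₂ := sumEquivOfNodupAppend s.leaves t.leaves hnd hmem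
      have htree : (⟨.node ω s t, ht⟩ : TreeMonomial V M) =
          (((((TreeMonomial.corolla ω).map e₀).graft s').map e₁).graft t').map e₂ := by
        apply Subtype.ext
        simp only [TreeMonomial.map, TreeMonomial.graft, TreeMonomial.corolla, BinTree.graft,
          BinTree.map, BinTree.bind, BinTree.bind_bind]
        congr 1
        · conv_lhs => rw [← hss]
          change _ = (s'.1.bind _).bind _
          rw [BinTree.bind_bind]
          rfl
        · conv_lhs => rw [← htt]
          change _ = (t'.1.bind _).bind _
          rw [BinTree.bind_bind]
          rfl
      rw [htree, treeOp_map, treeOp_graft, treeOp_map, treeOp_graft, treeOp_map, ← htree,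
        β.act_map, β.act_comp, β.act_map, β.act_comp, β.act_map]
      have ih₁ := hS _ (fun x => f x.1) s' (fun x => a x.1) (by
        rw [← hs]
        conv_rhs => rw [← hss]
        simp [BinTree.map, BinTree.bind_bind, BinTree.bind])
      have ih₂ := hT _ (fun x => f x.1) t' (fun x => a x.1) (by
        rw [← ht']
        conv_rhs => rw [← htt]
        simp [BinTree.map, BinTree.bind_bind, BinTree.bind])
      have hev : (BinTree.node ω s t).eval β.corollaOp a = β.corollaOp ω
          (s'.1.eval β.corollaOp fun x => a x.1) (t'.1.eval β.corollaOp fun x => a x.1) := by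
        conv_lhs => rw [← hss, ← htt]
        simp [BinTree.eval, BinTree.eval_map]
      rw [hev, ← ih₁, ← ih₂, corollaOp, MultilinearMap.toBilinear_apply]
      congr 1
      funext i
      fin_cases i <;> rfl

/-- An algebra over the operad of trees is determined by its binary operations. -/
theorem eq_treeAlgebra (β : (treeOperad k V).AlgebraOn A) : β = treeAlgebra β.corollaOp := by
  ext L _ p a
  change TreeMonomial V L →₀ k at p
  suffices H : (β.act (L := L) : (TreeMonomial V L →₀ k) →ₗ[k] _) = treeAct β.corollaOp L from
    congrArg (fun φ => φ p a) H
  refine Finsupp.lhom_ext' fun t => LinearMap.ext_ring (MultilinearMap.ext fun a => ?_)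
  refine (β.act_treeOp t a).trans ?_
  simp [treeAct_single]

end SymOperad.AlgebraOn

end Trees

/-! ### Algebras over a presented binary operad -/

namespace BinaryPresentation

variable {k : Type u} [Field k] {D : BinaryPresentation.{u, v} k} {A : Type w} [AddCommGroup A]
  [Module k A]

/-- The bilinear operations by which the generators of a presented operad act on an algebra. -/
noncomputable def genOp (β : D.operad.AlgebraOn A) (ω : D.V) : A →ₗ[k] A →ₗ[k] A :=
  (β.act (D.gen ω)).toBilinear

theorem genOp_apply (β : D.operad.AlgebraOn A) (ω : D.V) (x y : A) :
    genOp β ω x y = β.act (D.gen ω) ![x, y] := rfl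

/-- The class of a linear combination of tree monomials acts by the evaluation of trees in the
operations of the generators. -/
theorem act_mk (β : D.operad.AlgebraOn A) {L : Type} [Finite L] (p : TreeMonomial D.V L →₀ k) :
    β.act (L := L) (Submodule.Quotient.mk p) = treeAct (genOp β) L p := by
  have h := SymOperad.AlgebraOn.eq_treeAlgebra (SymOperad.AlgebraOn.ofQuotient β)
  exact congrArg (fun γ : (treeOperad k D.V).AlgebraOn A => γ.act (L := L) p) h

/-- An algebra over a presented operad is determined by the operations of the generators. -/
theorem algebraOn_ext {β β' : D.operad.AlgebraOn A} (h : genOp β = genOp β') : β = β' := by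
  ext L _ p a
  obtain ⟨p, rfl⟩ := Submodule.Quotient.mk_surjective _ p
  exact congrArg (fun φ => φ a) ((act_mk β p).trans (h ▸ (act_mk β' p).symm))

theorem treeAct_genOp_eq_zero (β : D.operad.AlgebraOn A) {L : Type} [Finite L]
    {r : TreeMonomial D.V L →₀ k} (hr : D.Relator L r) : treeAct (genOp β) L r = 0 := by
  have h0 : (Submodule.Quotient.mk r : D.operad.obj L) = 0 :=
    (Submodule.Quotient.mk_eq_zero _).2 <| (Submodule.mem_iInf _).2 fun I =>
      (Submodule.mem_iInf _).2 fun hI => hI L hr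
  exact (act_mk β r).symm.trans ((congrArg β.act h0).trans (map_zero β.act))

theorem genOp_add (β : D.operad.AlgebraOn A) (ω ω' : D.V) :
    genOp β (ω + ω') = genOp β ω + genOp β ω' := by
  ext x y
  have h := congrArg (fun φ => φ ![x, y]) (treeAct_genOp_eq_zero β (.add ω ω'))
  simp only [map_sub, sub_apply, treeAct_corolla, zero_apply] at h
  simpa [sub_sub, sub_eq_zero] using h

theorem genOp_smul (β : D.operad.AlgebraOn A) (c : k) (ω : D.V) :
    genOp β (c • ω) = c • genOp β ω := by
  ext x y
  have h := congrArg (fun φ => φ ![x, y]) (treeAct_genOp_eq_zero β (.smul c ω))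
  simp only [map_sub, map_smul, sub_apply, smul_apply, treeAct_corolla, zero_apply] at h
  simpa [sub_eq_zero] using h

theorem genOp_zero (β : D.operad.AlgebraOn A) : genOp β 0 = 0 := by
  simpa using genOp_smul β 0 0

theorem genOp_swap (β : D.operad.AlgebraOn A) (ω : D.V) (x y : A) :
    genOp β (D.swap ω) x y = genOp β ω y x := by
  have h := congrArg (fun φ => φ ![x, y]) (treeAct_genOp_eq_zero β (.symm ω))
  simp only [map_sub, sub_apply, treeAct_corolla, treeAct_corolla_swap, zero_apply] at h
  simpa [sub_eq_zero] using h

/-- Bilinear operations that satisfy the relations of a presentation define an algebra. -/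
noncomputable def algebraOfOps (m : D.V → A →ₗ[k] A →ₗ[k] A)
    (add : ∀ ω ω', m (ω + ω') = m ω + m ω') (smul : ∀ (c : k) ω, m (c • ω) = c • m ω)
    (symm : ∀ ω x y, m (D.swap ω) x y = m ω y x)
    (rel : ∀ (L : Type) [Finite L], ∀ r ∈ D.rels L, treeAct m L r = 0) :
    D.operad.AlgebraOn A :=
  (treeAlgebra m).descend _ (by
    intro L _ r hr
    change treeAct m L r = 0
    induction hr with
    | add ω ω' =>
      ext a
      simp [treeAct_corolla, add]
    | smul c ω =>
      ext a
      simp only [map_sub, map_smul, sub_apply, smul_apply, treeAct_corolla, zero_apply, smul,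
        LinearMap.smul_apply, sub_self]
    | symm ω =>
      ext a
      simp only [map_sub, sub_apply, treeAct_corolla, treeAct_corolla_swap, zero_apply, symm,
        sub_self]
    | rel L r hr => exact rel L r hr)

theorem genOp_algebraOfOps (m : D.V → A →ₗ[k] A →ₗ[k] A) (add smul symm rel) :
    genOp (algebraOfOps (D := D) m add smul symm rel) = m := by
  funext ω
  ext x y
  exact treeAct_corolla m ω ![x, y]

end BinaryPresentation

/-! ### Rescaling bilinear operations by weights -/

section Weights

variable {k : Type u} [Field k] {A : Type w} [AddCommGroup A] [Module k A]
  {piece : ℕ+ → Submodule k A}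

theorem DirectSum.IsInternal.span_homogeneous (hA : DirectSum.IsInternal piece) :
    Submodule.span k (Set.range (Subtype.val : {x : A // ∃ i, x ∈ piece i} → A)) = ⊤ := by
  rw [eq_top_iff, ← hA.submodule_iSup_eq_top, iSup_le_iff]
  exact fun i x hx => Submodule.subset_span ⟨⟨x, i, hx⟩, rfl⟩

/-- Bilinear maps that agree on homogeneous elements are equal. -/
theorem DirectSum.IsInternal.bilinear_ext {B : Type*} [AddCommGroup B] [Module k B]
    (hA : DirectSum.IsInternal piece) {b b' : A →ₗ[k] A →ₗ[k] B}
    (h : ∀ i j, ∀ x ∈ piece i, ∀ y ∈ piece j, b x y = b' x y) : b = b' := by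
  refine LinearMap.ext_on_range hA.span_homogeneous fun ⟨x, i, hx⟩ => ?_
  exact LinearMap.ext_on_range hA.span_homogeneous fun ⟨y, j, hy⟩ => h i j x hx y hy

/-- Multilinear maps that agree on homogeneous elements are equal. -/
theorem DirectSum.IsInternal.multilinear_ext {B : Type*} [AddCommGroup B] [Module k B]
    {L : Type} [Finite L] (hA : DirectSum.IsInternal piece)
    {f g : MultilinearMap k (fun _ : L => A) B}
    (h : ∀ (n : L → ℕ+) (a : L → A), (∀ l, a l ∈ piece (n l)) → f a = g a) : f = g := by
  refine MultilinearMap.ext_of_span_eq_top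
    (g := fun _ : L => (Subtype.val : {x : A // ∃ i, x ∈ piece i} → A))
    (fun _ => hA.span_homogeneous) fun a => ?_
  exact h (fun l => (a l).2.choose) _ fun l => (a l).2.choose_spec

/-- A space with a grading as a direct sum of its homogeneous parts. -/
noncomputable def DirectSum.IsInternal.toDirectSum (hA : DirectSum.IsInternal piece) :
    A →ₗ[k] DirectSum ℕ+ fun i => piece i :=
  (LinearEquiv.ofBijective (DirectSum.coeLinearMap piece)
    (show Function.Bijective (DirectSum.coeLinearMap piece) from hA)).symm

theorem DirectSum.IsInternal.toDirectSum_of_mem (hA : DirectSum.IsInternal piece) {i : ℕ+} {x : A}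
    (hx : x ∈ piece i) :
    hA.toDirectSum x = DirectSum.lof k ℕ+ (fun i => piece i) i ⟨x, hx⟩ :=
  (LinearEquiv.symm_apply_eq _).2 (DirectSum.coeLinearMap_lof piece i ⟨x, hx⟩).symm

/-- The bilinear operation `c |x| |y| • b x y` on homogeneous elements `x`, `y` of a graded
space, extended bilinearly. -/
noncomputable def rescale (hA : DirectSum.IsInternal piece) (c : ℕ+ → ℕ+ → k)
    (b : A →ₗ[k] A →ₗ[k] A) : A →ₗ[k] A →ₗ[k] A :=
  (DirectSum.toModule k ℕ+ _ fun i => (DirectSum.toModule k ℕ+ _ fun j =>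
    (c i j • b.compl₁₂ (piece i).subtype (piece j).subtype).flip).flip).compl₁₂
      hA.toDirectSum hA.toDirectSum

theorem rescale_apply (hA : DirectSum.IsInternal piece) (c : ℕ+ → ℕ+ → k)
    (b : A →ₗ[k] A →ₗ[k] A) {i j : ℕ+} {x y : A} (hx : x ∈ piece i) (hy : y ∈ piece j) :
    rescale hA c b x y = c i j • b x y := by
  simp [rescale, hA.toDirectSum_of_mem hx, hA.toDirectSum_of_mem hy]

end Weights

/-! ### Weights of trees -/

namespace BinTree

variable {k : Type u} [Field k] {V : Type v} {A : Type w} [AddCommGroup A] [Module k A] {L : Type}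

/-- The total weight of the leaves of a tree. -/
def weight (n : L → ℕ+) : BinTree V L → ℕ+
  | leaf l => n l
  | node _ s t => s.weight n + t.weight n

theorem coe_weight (n : L → ℕ+) (t : BinTree V L) :
    (t.weight n : ℕ) = (t.leaves.map fun l => (n l : ℕ)).sum := by
  induction t with
  | leaf l => simp [weight, leaves]
  | node ω s t hs ht => simp [weight, leaves, hs, ht]

/-- Trees with the same leaf labels have the same weight. -/
theorem IsMultilinear.weight_eq {s t : BinTree V L} (hs : s.IsMultilinear) (ht : t.IsMultilinear)
    (n : L → ℕ+) : s.weight n = t.weight n := by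
  refine PNat.coe_injective ?_
  rw [coe_weight, coe_weight]
  exact (((List.perm_ext_iff_of_nodup hs.1 ht.1).2 fun l => iff_of_true (hs.2 l) (ht.2 l)).map
    _).sum_eq

variable {piece : ℕ+ → Submodule k A} {m : V → A →ₗ[k] A →ₗ[k] A}

theorem eval_mem (hm : ∀ ω i j, ∀ x ∈ piece i, ∀ y ∈ piece j, m ω x y ∈ piece (i + j))
    (t : BinTree V L) {n : L → ℕ+} {a : L → A} (ha : ∀ l, a l ∈ piece (n l)) :
    t.eval m a ∈ piece (t.weight n) := by
  induction t with
  | leaf l => exact ha l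
  | node ω s t hs ht => exact hm ω _ _ _ hs _ ht

theorem eval_star {m' : V × V → A →ₗ[k] A →ₗ[k] A} (hm' : ∀ ω, m' (ω, ω) = m ω)
    (t : BinTree V L) (a : L → A) : t.star.eval m' a = t.eval m a := by
  induction t with
  | leaf l => rfl
  | node ω s t hs ht => simp [star, eval, hm', hs, ht]

/-- The factors `|left| / |total|` and `|right| / |total|` along the path from the root to the leaf
`x` telescope to the quotient of the weight of `x` by the weight of the tree. -/
theorem eval_disuccessor [CharZero k] [Zero V] {m' : V × V → A →ₗ[k] A →ₗ[k] A}
    (hm : ∀ ω i j, ∀ x ∈ piece i, ∀ y ∈ piece j, m ω x y ∈ piece (i + j))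
    (hm' : ∀ ω, m' (ω, ω) = m ω)
    (hprec : ∀ ω (i j : ℕ+), ∀ x ∈ piece i, ∀ y ∈ piece j,
      m' (ω, 0) x y = (((i : ℕ) : k) / (((i : ℕ) : k) + ((j : ℕ) : k))) • m ω x y)
    (hsucc : ∀ ω (i j : ℕ+), ∀ x ∈ piece i, ∀ y ∈ piece j,
      m' (0, ω) x y = (((j : ℕ) : k) / (((i : ℕ) : k) + ((j : ℕ) : k))) • m ω x y)
    (t : BinTree V L) {x : L} (hx : x ∈ t.leaves) {n : L → ℕ+} {a : L → A}
    (ha : ∀ l, a l ∈ piece (n l)) :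
    (t.disuccessor x).eval m' a =
      (((n x : ℕ) : k) / ((t.weight n : ℕ) : k)) • t.eval m a := by
  have hne (i : ℕ+) : ((i : ℕ) : k) ≠ 0 := Nat.cast_ne_zero.2 i.ne_zero
  induction t with
  | leaf l =>
    obtain rfl : x = l := by simpa [leaves] using hx
    simp [disuccessor, eval, weight]
  | node ω s t hs ht =>
    rw [disuccessor]
    split_ifs with h
    · rw [eval, hs h, eval_star hm', map_smul, LinearMap.smul_apply,
        hprec ω _ _ _ (eval_mem hm s ha) _ (eval_mem hm t ha), smul_smul,
        div_mul_div_cancel₀ (hne _), eval, weight, PNat.add_coe, Nat.cast_add]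
    · have h' : x ∈ t.leaves := (List.mem_append.1 hx).resolve_left h
      rw [eval, ht h', eval_star hm', map_smul,
        hsucc ω _ _ _ (eval_mem hm s ha) _ (eval_mem hm t ha), smul_smul,
        div_mul_div_cancel₀ (hne _), eval, weight, PNat.add_coe, Nat.cast_add]

end BinTree

/-! ### The Foissy functor -/

namespace BinaryPresentation

variable {k : Type u} [Field k] {D : BinaryPresentation.{u, v} k}

/-- The operation `α_≺ + β_≻` on a positively graded algebra:
`|x| / (|x| + |y|) α(x, y) + |y| / (|x| + |y|) β(x, y)` on homogeneous elements. -/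
noncomputable def foissyOp (A : PosGradedAlg.{u, v, w} D) (ω : D.V × D.V) :
    A.carrier →ₗ[k] A.carrier →ₗ[k] A.carrier :=
  rescale A.isInternal (fun i j => ((i : ℕ) : k) / (((i : ℕ) : k) + ((j : ℕ) : k)))
      (genOp A.str ω.1) +
    rescale A.isInternal (fun i j => ((j : ℕ) : k) / (((i : ℕ) : k) + ((j : ℕ) : k)))
      (genOp A.str ω.2)

theorem foissyOp_apply (A : PosGradedAlg.{u, v, w} D) (ω : D.V × D.V) {i j : ℕ+}
    {x y : A.carrier} (hx : x ∈ A.piece i) (hy : y ∈ A.piece j) :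
    foissyOp A ω x y =
      (((i : ℕ) : k) / (((i : ℕ) : k) + ((j : ℕ) : k))) • genOp A.str ω.1 x y +
      (((j : ℕ) : k) / (((i : ℕ) : k) + ((j : ℕ) : k))) • genOp A.str ω.2 x y := by
  simp [foissyOp, rescale_apply _ _ _ hx hy]

theorem foissyOp_add (A : PosGradedAlg.{u, v, w} D) (ω ω' : D.V × D.V) :
    foissyOp A (ω + ω') = foissyOp A ω + foissyOp A ω' :=
  A.isInternal.bilinear_ext fun i j x hx y hy => by
    simp only [LinearMap.add_apply, foissyOp_apply A _ hx hy, Prod.fst_add, Prod.snd_add,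
      genOp_add, smul_add]
    abel

theorem foissyOp_smul (A : PosGradedAlg.{u, v, w} D) (c : k) (ω : D.V × D.V) :
    foissyOp A (c • ω) = c • foissyOp A ω :=
  A.isInternal.bilinear_ext fun i j x hx y hy => by
    simp only [LinearMap.smul_apply, foissyOp_apply A _ hx hy, Prod.smul_fst, Prod.smul_snd,
      genOp_smul, smul_add, smul_comm c]

/-- Exchanging the arguments exchanges the two weight quotients, as the symmetric group action on
the generators of the disuccessor requires. -/
theorem foissyOp_swap (A : PosGradedAlg.{u, v, w} D) (ω : D.V × D.V) (x y : A.carrier) :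
    foissyOp A (D.swap ω.2, D.swap ω.1) x y = foissyOp A ω y x := by
  have h : foissyOp A (D.swap ω.2, D.swap ω.1) = (foissyOp A ω).flip :=
    A.isInternal.bilinear_ext fun i j x hx y hy => by
      rw [LinearMap.flip_apply, foissyOp_apply A _ hx hy, foissyOp_apply A _ hy hx,
        genOp_swap, genOp_swap, add_comm, add_comm ((i : ℕ) : k)]
  exact congrArg (fun b => b x y) h

/-- A relation of the disuccessor holds because, on arguments of fixed weights, it is the original
relation multiplied by a scalar which is the same for all of its trees. -/
theorem treeAct_foissyOp_disuccessor [CharZero k] (A : PosGradedAlg.{u, v, w} D) {L : Type}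
    [Finite L] {r : TreeMonomial D.V L →₀ k} (hr : r ∈ D.rels L) (x : L) :
    treeAct (foissyOp A) L (Finsupp.mapDomain (TreeMonomial.disuccessor x) r) = 0 := by
  refine A.isInternal.multilinear_ext fun n a ha => ?_
  have hdiag (ω : D.V) : foissyOp A (ω, ω) = genOp A.str ω := by
    refine A.isInternal.bilinear_ext fun i j x hx y hy => ?_
    have hne : ((i : ℕ) : k) + ((j : ℕ) : k) ≠ 0 := by
      exact_mod_cast (i + j).ne_zero
    rw [foissyOp_apply A _ hx hy, ← add_smul, ← add_div, div_self hne, one_smul]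
  -- The multiplier is computed from any tree of the relation, if there is one.
  obtain ⟨c, hc⟩ : ∃ c : k, ∀ t : TreeMonomial D.V L,
      (t.disuccessor x).1.eval (foissyOp A) a = c • t.1.eval (genOp A.str) a := by
    have key (t : TreeMonomial D.V L) := BinTree.eval_disuccessor (m := genOp A.str)
      (m' := foissyOp A) A.act_mem hdiag
      (fun ω i j x hx y hy => by simp [foissyOp_apply A _ hx hy, genOp_zero])
      (fun ω i j x hx y hy => by simp [foissyOp_apply A _ hx hy, genOp_zero])
      t.1 (t.2.2 x) ha
    rcases isEmpty_or_nonempty (TreeMonomial D.V L) with h | ⟨⟨t₀⟩⟩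
    · exact ⟨0, fun t => h.elim t⟩
    · exact ⟨((n x : ℕ) : k) / ((t₀.1.weight n : ℕ) : k), fun t => by
        rw [← t.2.weight_eq t₀.2 n]
        exact key t⟩
  have hall (p : TreeMonomial D.V L →₀ k) :
      treeAct (foissyOp A) L (Finsupp.mapDomain (TreeMonomial.disuccessor x) p) a =
        c • treeAct (genOp A.str) L p a := by
    induction p using Finsupp.induction_linear with
    | zero => simp
    | add f g hf hg => simp [Finsupp.mapDomain_add, hf, hg]
    | single t d => rw [Finsupp.mapDomain_single, treeAct_single, treeAct_single, hc, smul_comm]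
  rw [hall, treeAct_genOp_eq_zero A.str (.rel L r hr)]
  simp

/-- The algebra over the disuccessor on a positively graded algebra. -/
noncomputable def foissyAlgebra [CharZero k] (A : PosGradedAlg.{u, v, w} D) :
    D.disuccessor.operad.AlgebraOn A.carrier :=
  algebraOfOps (D := D.disuccessor) (foissyOp A)
    (foissyOp_add A) (foissyOp_smul A) (foissyOp_swap A)
    (by
      rintro L _ _ ⟨r, hr, x, rfl⟩
      exact treeAct_foissyOp_disuccessor A hr x)

theorem genOp_foissyAlgebra [CharZero k] (A : PosGradedAlg.{u, v, w} D) :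
    genOp (foissyAlgebra A) = foissyOp A :=
  genOp_algebraOfOps (D := D.disuccessor) _ _ _ _ _

theorem isFoissy_foissyAlgebra [CharZero k] (A : PosGradedAlg.{u, v, w} D) :
    IsFoissy A (foissyAlgebra A) := by
  have h (ω : D.V × D.V) (x y : A.carrier) :
      (foissyAlgebra A).act (D.disuccessor.gen ω) ![x, y] = foissyOp A ω x y :=
    congrArg (fun m => m ω x y) (genOp_foissyAlgebra A)
  intro ω i j x hx y hy
  rw [genPrec, genSucc, h, h, foissyOp_apply A _ hx hy, foissyOp_apply A _ hx hy]
  simp [genOp_zero, genOp_apply]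

/-- The formulas on homogeneous elements determine the operations of all generators, because the
generators `ω_≺` and `ω_≻` span and the homogeneous elements span. -/
theorem IsFoissy.eq_foissyAlgebra [CharZero k] {A : PosGradedAlg.{u, v, w} D}
    {β : D.disuccessor.operad.AlgebraOn A.carrier} (hβ : IsFoissy A β) : β = foissyAlgebra A := by
  refine algebraOn_ext ((funext fun ω => ?_).trans (genOp_foissyAlgebra A).symm)
  change D.V × D.V at ω
  refine A.isInternal.bilinear_ext fun i j x hx y hy => ?_
  have hadd : genOp β ω = genOp β ((ω.1, 0) : D.V × D.V) + genOp β ((0, ω.2) : D.V × D.V) := by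
    refine Eq.trans (congrArg (genOp β) ?_) (genOp_add (D := D.disuccessor) β (ω.1, 0) (0, ω.2))
    exact (Prod.fst_add_snd ω).symm
  rw [hadd, foissyOp_apply A _ hx hy]
  exact congrArg₂ (· + ·) (hβ ω.1 i j x hx y hy).1 (hβ ω.2 i j x hx y hy).2

/-- Weight-preserving morphisms commute with the rescaled operations. -/
theorem PosGradedAlg.Hom.map_foissyOp {A B : PosGradedAlg.{u, v, w} D} (f : A.Hom B)
    (ω : D.V × D.V) (x y : A.carrier) :
    f.toLin (foissyOp A ω x y) = foissyOp B ω (f.toLin x) (f.toLin y) := by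
  have hf (ω : D.V) (x y : A.carrier) :
      f.toLin (genOp A.str ω x y) = genOp B.str ω (f.toLin x) (f.toLin y) := by
    rw [genOp_apply, genOp_apply, f.map_act]
    congr 1
    funext i
    fin_cases i <;> rfl
  have h : (foissyOp A ω).compr₂ f.toLin = (foissyOp B ω).compl₁₂ f.toLin f.toLin :=
    A.isInternal.bilinear_ext fun i j x hx y hy => by
      simp [foissyOp_apply A ω hx hy,
        foissyOp_apply B ω (f.map_piece i x hx) (f.map_piece j y hy), hf]
  exact congrArg (fun b => b x y) h

theorem PosGradedAlg.Hom.map_foissyAlgebra_act [CharZero k] {A B : PosGradedAlg.{u, v, w} D}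
    (f : A.Hom B) {L : Type} [Finite L] (p : D.disuccessor.operad.obj L) (a : L → A.carrier) :
    f.toLin ((foissyAlgebra A).act p a) = (foissyAlgebra B).act p (fun l => f.toLin (a l)) := by
  obtain ⟨p, rfl⟩ := Submodule.Quotient.mk_surjective _ p
  refine Eq.trans (congrArg (fun φ => f.toLin (φ a)) (act_mk (foissyAlgebra A) p))
    (Eq.trans ?_ (congrArg (fun φ => φ fun l => f.toLin (a l)) (act_mk (foissyAlgebra B) p)).symm)
  rw [genOp_foissyAlgebra, genOp_foissyAlgebra]
  exact map_treeAct f.toLin f.map_foissyOp p a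

/-- The Foissy functor: the same space with the rescaled operations, and the same linear maps. -/
noncomputable def foissyFunctor [CharZero k] (D : BinaryPresentation.{u, v} k) :
    PosGradedAlg.{u, v, w} D ⥤ SymOperad.AlgCat.{u, max u v, w} D.disuccessor.operad where
  obj A := { carrier := A.carrier, str := foissyAlgebra A }
  map f := ⟨f.toLin, f.map_foissyAlgebra_act⟩

end BinaryPresentation

theorem mainTheorem5 {k : Type u} [Field k] [CharZero k] (D : BinaryPresentation.{u, v} k) :
    ∃ β : ∀ A : BinaryPresentation.PosGradedAlg.{u, v, w} D,
        D.disuccessor.operad.AlgebraOn A.carrier,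
      (∀ A, BinaryPresentation.IsFoissy A (β A) ∧
        ∀ β' : D.disuccessor.operad.AlgebraOn A.carrier,
          BinaryPresentation.IsFoissy A β' → β' = β A) ∧
      ∃ F : BinaryPresentation.PosGradedAlg.{u, v, w} D ⥤
          SymOperad.AlgCat.{u, max u v, w} D.disuccessor.operad,
        ∃ hF : ∀ A, F.obj A = { carrier := A.carrier, str := β A },
          ∀ (A B : BinaryPresentation.PosGradedAlg.{u, v, w} D) (f : A ⟶ B),
            SymOperad.AlgCat.Hom.toLin
              (eqToHom (hF A).symm ≫ F.map f ≫ eqToHom (hF B)) =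
            BinaryPresentation.PosGradedAlg.Hom.toLin f := by
  exact ⟨BinaryPresentation.foissyAlgebra, fun A =>
    ⟨BinaryPresentation.isFoissy_foissyAlgebra A, fun β' h => h.eq_foissyAlgebra⟩,
    BinaryPresentation.foissyFunctor D, fun A => rfl, fun A B f => rfl⟩
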